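/- Let $M$ be a compact affine manifold of dimension $n$, that is, a compact connected Hausdorff manifold without boundary with an atlas of charts in $\mathbb{R}^n$ whose coordinate changes are locally restrictions of affine transformations of $\mathbb{R}^n$. Let $p:\hat M\to M$ be a universal covering, $\pi_1(M)$ its group of deck transformations, and $D:\hat M\to\mathbb{R}^n$ a developing map, i.e. a map that near every point of $\hat M$ has the form $A\circ\varphi\circ p$ with $\varphi$ an affine chart of $M$ and $A$ an affine transformation of $\mathbb{R}^n$. Let $h:\pi_1(M)\to \mathrm{Aff}(\mathbb{R}^n)$ be the holonomy representation, where $h(\gamma)$ is the unique affine transformation with $D\circ\gamma=h(\gamma)\circ D$, and let $L(h(\gamma))$ be the linear part of $h(\gamma)$. Let $U\subset\mathbb{R}^n$ be a vector subspace with $L(h(\gamma))(U)=U$ for all $\gamma\in\pi_1(M)$. The foliation of $\mathbb{R}^n$ by the affine subspaces parallel to $U$ pulls back under $D$ to a $\pi_1(M)$-invariant foliation of $\hat M$, which descends to a foliation $\mathcal{F}^U_M$ of $M$, called the linear foliation with direction $U$. Its codimension is $\dim(\mathbb{R}^n/U)$. Its global holonomy is the representation $h_{\mathcal{F}^U_M}:\pi_1(M)\to\mathrm{Aff}(\mathbb{R}^n/U)$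 induced by $h$. **Theorem 4.1.** If $\mathcal{F}^U_M$ is transversely oriented (its normal bundle is oriented) and has codimension strictly greater than $0$, then its global holonomy $h_{\mathcal{F}^U_M}$ is not trivial: there is $\gamma\in\pi_1(M)$ such that $h_{\mathcal{F}^U_M}(\gamma)$ is not the identity of $\mathbb{R}^n/U$. -/

import Mathlib

open Filter Topology Set

/-! Affine manifolds are topological manifolds modelled on `ℝⁿ` with an atlas whose coordinate
changes are locally restrictions of affine transformations of `ℝⁿ`. -/

/-- The pregroupoid of locally affine maps of `ℝⁿ`: near each point of its domain, the map
coincides with an affine transformation of `ℝⁿ`. -/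
def affinePregroupoid (n : ℕ) : Pregroupoid (EuclideanSpace ℝ (Fin n)) where
  property f s := ∀ x ∈ s, ∃ A : EuclideanSpace ℝ (Fin n) ≃ᵃ[ℝ] EuclideanSpace ℝ (Fin n),
    ∀ᶠ y in 𝓝[s] x, f y = A y
  comp := by
    intro f g u v hf hg _ _ _ x hx
    obtain ⟨A, hA⟩ := hf x hx.1
    obtain ⟨B, hB⟩ := hg (f x) hx.2
    refine ⟨A.trans B, ?_⟩
    have hfx : f x = A x := hA.self_of_nhdsWithin hx.1
    have hA' : ∀ᶠ y in 𝓝[u ∩ f ⁻¹' v] x, f y = A y :=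
      hA.filter_mono (nhdsWithin_mono x inter_subset_left)
    have hAc : ContinuousAt A x := A.toAffineMap.continuous_of_finiteDimensional.continuousAt
    have ht : Tendsto f (𝓝[u ∩ f ⁻¹' v] x) (𝓝[v] (f x)) := by
      refine tendsto_nhdsWithin_iff.2 ⟨?_, ?_⟩
      · rw [hfx]
        exact (hAc.tendsto.mono_left nhdsWithin_le_nhds).congr'
          (hA'.mono fun y hy => hy.symm)
      · exact eventually_mem_nhdsWithin.mono fun y hy => hy.2
    filter_upwards [hA', ht.eventually hB] with y h1 h2
    simp only [Function.comp_apply, AffineEquiv.trans_apply]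
    rw [h2, h1]
  id_mem := fun x _ => ⟨AffineEquiv.refl ℝ _, Eventually.of_forall fun _ => rfl⟩
  locality := by
    intro f u _ h x hx
    obtain ⟨v, hv, hxv, hfv⟩ := h x hx
    obtain ⟨A, hA⟩ := hfv x ⟨hx, hxv⟩
    refine ⟨A, ?_⟩
    rwa [nhdsWithin_inter_of_mem' (mem_nhdsWithin_of_mem_nhds (hv.mem_nhds hxv))] at hA
  congr := by
    intro f g u _ h hf x hx
    obtain ⟨A, hA⟩ := hf x hx
    refine ⟨A, ?_⟩
    filter_upwards [hA, eventually_mem_nhdsWithin] with y h1 h2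
    rw [h y h2, h1]

/-- The groupoid of locally affine coordinate changes of `ℝⁿ`. -/
def affineGroupoid (n : ℕ) : StructureGroupoid (EuclideanSpace ℝ (Fin n)) :=
  (affinePregroupoid n).groupoid

/-- `M` is an `n`-dimensional affine manifold (without boundary): it is Hausdorff, connected, and
the coordinate changes of its atlas are locally affine.  (Second countability is automatic in the
compact case.) -/
class IsAffineManifold (n : ℕ) (M : Type*) [TopologicalSpace M]
    [ChartedSpace (EuclideanSpace ℝ (Fin n)) M] : Prop
    extends HasGroupoid M (affineGroupoid n) where
  t2 : T2Space M
  connected : ConnectedSpace M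

/-- `p : N → M` is a universal covering of `M`. -/
structure IsUniversalCover {N M : Type*} [TopologicalSpace N] [TopologicalSpace M]
    (p : N → M) : Prop where
  isCoveringMap : IsCoveringMap p
  simplyConnected : SimplyConnectedSpace N

/-- The group of deck transformations of `p : N → M`.  For the universal covering this is
the fundamental group of `M`, acting on the universal cover. -/
def deckGroup {N M : Type*} [TopologicalSpace N] (p : N → M) : Subgroup (N ≃ₜ N) where
  carrier := {γ | ∀ x, p (γ x) = p x}
  one_mem' := fun _ => rfl
  mul_mem' := by
    intro a b ha hb x
    exact (ha (b x)).trans (hb x)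
  inv_mem' := by
    intro a ha x
    have h := ha (a.symm x)
    rw [Homeomorph.apply_symm_apply] at h
    exact h.symm

/-- `D : N → ℝⁿ` is a developing map of the affine manifold `M` with universal covering
`p : N → M`: near every point, `D` is an affine chart of the affine structure which `p` pulls back
from `M`, i.e. it differs from `φ ∘ p`, `φ` any chart of `M`, by an affine transformation. -/
def IsDevelopingMap {n : ℕ} {N M : Type*} [TopologicalSpace N] [TopologicalSpace M]
    [ChartedSpace (EuclideanSpace ℝ (Fin n)) M] (p : N → M)
    (D : N → EuclideanSpace ℝ (Fin n)) : Prop :=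
  ∀ x : N, ∀ φ ∈ atlas (EuclideanSpace ℝ (Fin n)) M, p x ∈ φ.source →
    ∃ A : EuclideanSpace ℝ (Fin n) ≃ᵃ[ℝ] EuclideanSpace ℝ (Fin n),
      ∀ᶠ y in 𝓝 x, D y = A (φ (p y))

section Developing

variable {n : ℕ} {N M : Type*} [TopologicalSpace N] [TopologicalSpace M]
  [ChartedSpace (EuclideanSpace ℝ (Fin n)) M] {p : N → M}
  {D D' : N → EuclideanSpace ℝ (Fin n)}

theorem affineEquiv_eq_of_eventuallyEq
    {A B : EuclideanSpace ℝ (Fin n) ≃ᵃ[ℝ] EuclideanSpace ℝ (Fin n)}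
    {z : EuclideanSpace ℝ (Fin n)} (h : ∀ᶠ y in 𝓝 z, A y = B y) : A = B := by
  obtain ⟨s, hs, hso, hzs⟩ := eventually_nhds_iff.1 h
  have hspan : affineSpan ℝ s = ⊤ := hso.affineSpan_eq_top ⟨z, hzs⟩
  apply AffineEquiv.toAffineMap_injective
  exact AffineMap.ext_on hspan hs

theorem IsDevelopingMap.map_nhds (hp : IsCoveringMap p) (hD : IsDevelopingMap p D) (x : N) :
    map D (𝓝 x) = 𝓝 (D x) := by
  obtain ⟨A, hA⟩ := hD x _ (chart_mem_atlas (EuclideanSpace ℝ (Fin n)) (p x))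
    (mem_chart_source _ _)
  have h1 : map p (𝓝 x) = 𝓝 (p x) := hp.isLocalHomeomorph.map_nhds_eq x
  have h2 := (chartAt (EuclideanSpace ℝ (Fin n)) (p x)).map_nhds_eq (mem_chart_source _ (p x))
  have h3 : map A (𝓝 (chartAt (EuclideanSpace ℝ (Fin n)) (p x) (p x))) =
      𝓝 (A (chartAt (EuclideanSpace ℝ (Fin n)) (p x) (p x))) :=
    A.toContinuousAffineEquiv.toHomeomorph.map_nhds_eq _
  rw [Filter.map_congr hA, hA.self_of_nhds, ← h3, ← h2, ← h1, Filter.map_map, Filter.map_map]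
  rfl

/-- Two developing maps on the same connected covering differ by exactly one affine
transformation. -/
theorem IsDevelopingMap.existsUnique_affineEquiv [ConnectedSpace N] (hp : IsCoveringMap p)
    (hD : IsDevelopingMap p D) (hD' : IsDevelopingMap p D') :
    ∃! A : EuclideanSpace ℝ (Fin n) ≃ᵃ[ℝ] EuclideanSpace ℝ (Fin n), ∀ x, D' x = A (D x) := by
  have loc : ∀ x, ∃ A : EuclideanSpace ℝ (Fin n) ≃ᵃ[ℝ] EuclideanSpace ℝ (Fin n),
      ∀ᶠ y in 𝓝 x, D' y = A (D y) := by
    intro x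
    obtain ⟨A, hA⟩ := hD x _ (chart_mem_atlas (EuclideanSpace ℝ (Fin n)) (p x))
      (mem_chart_source _ _)
    obtain ⟨B, hB⟩ := hD' x _ (chart_mem_atlas (EuclideanSpace ℝ (Fin n)) (p x))
      (mem_chart_source _ _)
    refine ⟨A.symm.trans B, ?_⟩
    filter_upwards [hA, hB] with y h1 h2
    rw [h1, h2]
    simp
  have uniq : ∀ (x : N) (A B : EuclideanSpace ℝ (Fin n) ≃ᵃ[ℝ] EuclideanSpace ℝ (Fin n)),
      (∀ᶠ y in 𝓝 x, A (D y) = B (D y)) → A = B := by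
    intro x A B h
    refine affineEquiv_eq_of_eventuallyEq (z := D x) ?_
    rw [← hD.map_nhds hp x]
    exact h
  obtain ⟨x₀⟩ : Nonempty N := inferInstance
  obtain ⟨A, hA⟩ := loc x₀
  refine ⟨A, ?_, ?_⟩
  · have hclopen : IsClopen {x | ∀ᶠ y in 𝓝 x, D' y = A (D y)} := by
      refine ⟨?_, isOpen_setOfPred_eventually_nhds⟩
      refine isClosed_of_closure_subset fun x hx => ?_
      obtain ⟨B, hB⟩ := loc x
      obtain ⟨y, hy1, hy2⟩ := mem_closure_iff_nhds.1 hx _ (eventually_eventually_nhds.2 hB)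
      have hBA : B = A := by
        refine uniq y B A ?_
        have hy1' : ∀ᶠ z in 𝓝 y, D' z = B (D z) := hy1
        have hy2' : ∀ᶠ z in 𝓝 y, D' z = A (D z) := hy2
        filter_upwards [hy1', hy2'] with z h1 h2
        rw [← h1, h2]
      rw [hBA] at hB
      exact hB
    have huniv := hclopen.eq_univ ⟨x₀, hA⟩
    intro x
    have hx : x ∈ {x | ∀ᶠ y in 𝓝 x, D' y = A (D y)} := huniv ▸ mem_univ x
    have hx' : ∀ᶠ y in 𝓝 x, D' y = A (D y) := hx
    exact hx'.self_of_nhds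
  · intro B hB
    refine uniq x₀ B A ?_
    filter_upwards [hA] with y hy
    rw [← hB y, hy]

theorem IsDevelopingMap.comp_deck (hD : IsDevelopingMap p D) (γ : deckGroup p) :
    IsDevelopingMap p (fun x => D (γ.1 x)) := by
  intro x φ hφ hx
  have hγ := γ.2
  obtain ⟨A, hA⟩ := hD (γ.1 x) φ hφ (by rw [hγ x]; exact hx)
  refine ⟨A, ?_⟩
  filter_upwards [γ.1.continuous.continuousAt.eventually hA] with y hy
  rw [hy, hγ y]

theorem IsDevelopingMap.existsUnique_holonomy (hp : IsUniversalCover p)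
    (hD : IsDevelopingMap p D) (γ : deckGroup p) :
    ∃! A : EuclideanSpace ℝ (Fin n) ≃ᵃ[ℝ] EuclideanSpace ℝ (Fin n),
      ∀ x, D (γ.1 x) = A (D x) := by
  have := hp.simplyConnected
  exact hD.existsUnique_affineEquiv hp.isCoveringMap (hD.comp_deck γ)

/-- The holonomy representation `h : π₁(M) → Aff(ℝⁿ)`: for a deck transformation `γ`, `h γ` is the
unique affine transformation of `ℝⁿ` with `D ∘ γ = h γ ∘ D`. -/
noncomputable def holonomy (hp : IsUniversalCover p) (hD : IsDevelopingMap p D) :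
    deckGroup p →* (EuclideanSpace ℝ (Fin n) ≃ᵃ[ℝ] EuclideanSpace ℝ (Fin n)) where
  toFun γ := (hD.existsUnique_holonomy hp γ).choose
  map_one' :=
    ((hD.existsUnique_holonomy hp 1).choose_spec.2 1 fun _ => rfl).symm
  map_mul' γ δ := by
    refine ((hD.existsUnique_holonomy hp (γ * δ)).choose_spec.2 _ fun x => ?_).symm
    have h1 := (hD.existsUnique_holonomy hp γ).choose_spec.1 (δ.1 x)
    have h2 := (hD.existsUnique_holonomy hp δ).choose_spec.1 x
    rw [h2] at h1
    exact h1

theorem holonomy_apply (hp : IsUniversalCover p) (hD : IsDevelopingMap p D) (γ : deckGroup p)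
    (x : N) : D (γ.1 x) = holonomy hp hD γ (D x) :=
  (hD.existsUnique_holonomy hp γ).choose_spec.1 x

end Developing

/-- The affine transformation of `V ⧸ U` induced by an affine transformation `g` of `V` whose linear
part maps `U` onto itself; see `affineQuotient_mk`. -/
noncomputable def affineQuotient {V : Type*} [AddCommGroup V] [Module ℝ V] (U : Submodule ℝ V)
    (g : V ≃ᵃ[ℝ] V) (hg : U.map (g.linear : V →ₗ[ℝ] V) = U) : (V ⧸ U) ≃ᵃ[ℝ] (V ⧸ U) :=
  (Submodule.Quotient.equiv U U g.linear hg).toAffineEquiv.trans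
    (AffineEquiv.constVAdd ℝ (V ⧸ U) (Submodule.Quotient.mk (g 0)))

theorem affineQuotient_mk {V : Type*} [AddCommGroup V] [Module ℝ V] (U : Submodule ℝ V)
    (g : V ≃ᵃ[ℝ] V) (hg : U.map (g.linear : V →ₗ[ℝ] V) = U) (x : V) :
    affineQuotient U g hg (Submodule.Quotient.mk x) = Submodule.Quotient.mk (g x) := by
  have h : g x = g 0 + g.linear x := by
    have := g.map_vadd 0 x
    simp only [vadd_eq_add, add_zero] at this
    rw [this, add_comm]
  rw [h, Submodule.Quotient.mk_add]
  rfl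

section Foliation

variable {n : ℕ} {N M : Type*} [TopologicalSpace N] [TopologicalSpace M]
  [ChartedSpace (EuclideanSpace ℝ (Fin n)) M] {p : N → M}
  {D : N → EuclideanSpace ℝ (Fin n)}

/-- A linear foliation of the affine manifold `M`.  It is given by its direction, a vector subspace
`U` of `ℝⁿ` which the linear holonomy maps onto itself: the foliation of `ℝⁿ` by the affine
subspaces parallel to `U` pulls back under `D` to the universal cover, and then descends to `M`. -/
structure LinearFoliation (hp : IsUniversalCover p) (hD : IsDevelopingMap p D) where
  direction : Submodule ℝ (EuclideanSpace ℝ (Fin n))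
  map_direction : ∀ γ : deckGroup p,
    direction.map ((holonomy hp hD γ).linear :
      EuclideanSpace ℝ (Fin n) →ₗ[ℝ] EuclideanSpace ℝ (Fin n)) = direction

namespace LinearFoliation

variable {hp : IsUniversalCover p} {hD : IsDevelopingMap p D}

/-- The leaf through `x` of the foliation induced on the universal cover: the connected component
of `x` in the preimage under `D` of the affine subspace `D x + U`. -/
def coverLeaf (F : LinearFoliation hp hD) (x : N) : Set N :=
  connectedComponentIn {y | D y - D x ∈ F.direction} x

/-- The leaf of the foliation of `M` below the point `x` of the universal cover. -/
def leaf (F : LinearFoliation hp hD) (x : N) : Set M :=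
  p '' F.coverLeaf x

/-- The model `ℝⁿ ⧸ U` of the normal spaces of the foliation. -/
abbrev Transverse (F : LinearFoliation hp hD) : Type :=
  EuclideanSpace ℝ (Fin n) ⧸ F.direction

/-- The codimension of the foliation. -/
noncomputable def codim (F : LinearFoliation hp hD) : ℕ :=
  Module.finrank ℝ F.Transverse

/-- The global holonomy of a linear foliation: the representation of `π₁(M)` in `Aff(ℝⁿ ⧸ U)`
induced by the holonomy of `M`. -/
noncomputable def globalHolonomy (F : LinearFoliation hp hD) :
    deckGroup p →* (F.Transverse ≃ᵃ[ℝ] F.Transverse) where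
  toFun γ := affineQuotient F.direction (holonomy hp hD γ) (F.map_direction γ)
  map_one' := by
    ext v
    obtain ⟨x, rfl⟩ := Submodule.Quotient.mk_surjective _ v
    rw [affineQuotient_mk, map_one]
    rfl
  map_mul' γ δ := by
    ext v
    obtain ⟨x, rfl⟩ := Submodule.Quotient.mk_surjective _ v
    rw [AffineEquiv.mul_def, AffineEquiv.trans_apply, affineQuotient_mk, affineQuotient_mk,
      affineQuotient_mk, map_mul]
    rfl

/-- A transverse orientation: a continuous choice of orientations of the normal spaces of the
foliation of `M`.  At the point `p x`, the differential of `D` at `x` identifies the normal space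
with `ℝⁿ ⧸ U`; replacing `x` by `γ x` changes the identification by the linear part of the global
holonomy of `γ`.  So the choice is a locally constant function on the universal cover with values in
the orientations of `ℝⁿ ⧸ U` which is equivariant under deck transformations. -/
structure TransverseOrientation (F : LinearFoliation hp hD) where
  orientation : N → Orientation ℝ F.Transverse (Fin F.codim)
  isLocallyConstant : IsLocallyConstant orientation
  equivariant : ∀ (γ : deckGroup p) (x : N),
    orientation (γ.1 x) =
      Orientation.map (Fin F.codim) (F.globalHolonomy γ).linear (orientation x)

end LinearFoliation

end Foliation

/-! If the global holonomy were trivial, `D` modulo `U` would be invariant under deck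
transformations. These act transitively on the fibres of `p`
(`IsUniversalCover.exists_deck_apply_eq`), so it would descend to a continuous map from `M` to `ℝⁿ ⧸
U`. Its image is compact because `M` is, and open because `D` (`IsDevelopingMap.isOpenMap`) and the
projection are open. By connectedness it would be all of `ℝⁿ ⧸ U`, which is not compact in positive
dimension. -/

theorem IsCoveringMap.locallyPathConnectedSpace {N M : Type*} [TopologicalSpace N]
    [TopologicalSpace M] [LocallyPathConnectedSpace M] {p : N → M} (hp : IsCoveringMap p) :
    LocallyPathConnectedSpace N := by
  choose e he _ using hp.isLocalHomeomorph
  -- The local inverses of `p` make `N` a space modelled on `M`, and local path connectedness passes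
  -- from model to space.
  let _ : ChartedSpace M N :=
    { atlas := range e
      chartAt := e
      mem_chart_source := he
      chart_mem_atlas := mem_range_self }
  exact ChartedSpace.locallyPathConnectedSpace M N

/-- The endpoint of a lifted path lies over the endpoint of the path. -/
theorem IsCoveringMap.surjective {N M : Type*} [TopologicalSpace N] [TopologicalSpace M]
    [Nonempty N] [PathConnectedSpace M] {p : N → M} (hp : IsCoveringMap p) :
    Function.Surjective p := by
  intro y
  obtain ⟨x⟩ : Nonempty N := inferInstance
  let γ : Path (p x) y := (PathConnectedSpace.joined (p x) y).somePath
  exact ⟨hp.liftPath γ x γ.source 1, (congr_fun (hp.liftPath_lifts γ x γ.source) 1).trans γ.target⟩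

/-- The deck transformations of a universal covering are transitive on its fibres. -/
theorem IsUniversalCover.exists_deck_apply_eq {N M : Type*} [TopologicalSpace N]
    [TopologicalSpace M] [LocallyPathConnectedSpace M] {p : N → M} (hp : IsUniversalCover p)
    {x y : N} (hxy : p x = p y) : ∃ γ : deckGroup p, γ.1 x = y := by
  have := hp.simplyConnected
  have cov := hp.isCoveringMap
  have := cov.locallyPathConnectedSpace
  -- As `N` is simply connected and locally path connected, `p` lifts through itself with any
  -- prescribed base point in the fibre.
  obtain ⟨f, ⟨hfx, hf⟩, -⟩ :=
    cov.existsUnique_continuousMap_lifts ⟨p, cov.continuous⟩ x y hxy.symm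
  obtain ⟨g, ⟨hgy, hg⟩, -⟩ :=
    cov.existsUnique_continuousMap_lifts ⟨p, cov.continuous⟩ y x hxy
  have hf' : ∀ z, p (f z) = p z := congr_fun hf
  have hg' : ∀ z, p (g z) = p z := congr_fun hg
  -- Both sides lift `p` and agree at `x`, hence everywhere on the connected space `N`.
  have hgf : g ∘ f = id :=
    cov.eq_of_comp_eq (g.continuous.comp f.continuous) continuous_id
      (funext fun z => (hg' _).trans (hf' z)) x (by simp [hfx, hgy])
  have hfg : f ∘ g = id :=
    cov.eq_of_comp_eq (f.continuous.comp g.continuous) continuous_id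
      (funext fun z => (hf' _).trans (hg' z)) y (by simp [hfx, hgy])
  exact ⟨⟨⟨⟨f, g, congr_fun hgf, congr_fun hfg⟩, f.continuous, g.continuous⟩, hf'⟩, hfx⟩

/-- Of the two inequalities in `map D (𝓝 x) = 𝓝 (D x)`, `≥` is openness; `≤` is continuity. -/
theorem IsDevelopingMap.isOpenMap {n : ℕ} {M N : Type*} [TopologicalSpace M]
    [ChartedSpace (EuclideanSpace ℝ (Fin n)) M] [TopologicalSpace N] {p : N → M}
    (hp : IsCoveringMap p) {D : N → EuclideanSpace ℝ (Fin n)} (hD : IsDevelopingMap p D) :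
    IsOpenMap D :=
  IsOpenMap.of_nhds_le fun x => (hD.map_nhds hp x).ge

theorem IsDevelopingMap.continuous {n : ℕ} {M N : Type*} [TopologicalSpace M]
    [ChartedSpace (EuclideanSpace ℝ (Fin n)) M] [TopologicalSpace N] {p : N → M}
    (hp : IsCoveringMap p) {D : N → EuclideanSpace ℝ (Fin n)} (hD : IsDevelopingMap p D) :
    Continuous D :=
  continuous_iff_continuousAt.2 fun x => (hD.map_nhds hp x).le

/-- A linear foliation of positive codimension on a compact affine manifold has nontrivial global
holonomy: otherwise the developing map modulo the direction descends to an open continuous map from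
the manifold onto a subset of `ℝⁿ ⧸ U`, which would be compact and open. -/
theorem LinearFoliation.globalHolonomy_ne_one {n : ℕ} {M N : Type*} [TopologicalSpace M]
    [ChartedSpace (EuclideanSpace ℝ (Fin n)) M] [ConnectedSpace M] [CompactSpace M]
    [TopologicalSpace N] {p : N → M} {hp : IsUniversalCover p}
    {D : N → EuclideanSpace ℝ (Fin n)} {hD : IsDevelopingMap p D}
    (F : LinearFoliation hp hD) (hF : 0 < F.codim) : F.globalHolonomy ≠ 1 := by
  intro h
  have cov := hp.isCoveringMap
  have := hp.simplyConnected
  have := ChartedSpace.locallyPathConnectedSpace (EuclideanSpace ℝ (Fin n)) M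
  have : PathConnectedSpace M := pathConnectedSpace_iff_connectedSpace.2 inferInstance
  have hq := cov.isQuotientMap cov.surjective
  let f : C(N, F.Transverse) :=
    ⟨fun x => F.direction.mkQ (D x), F.direction.continuous_mkQ.comp (hD.continuous cov)⟩
  have hf : IsOpenMap f := F.direction.isOpenMap_mkQ.comp (hD.isOpenMap cov)
  have hinv : ∀ x y, p x = p y → f x = f y := by
    intro x y hxy
    obtain ⟨γ, rfl⟩ := hp.exists_deck_apply_eq hxy
    have h1 := affineQuotient_mk F.direction (holonomy hp hD γ) (F.map_direction γ) (D x)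
    rw [← holonomy_apply] at h1
    -- By `h`, the left side of `h1` is the class of `D x` itself.
    exact (congr_fun (congr_arg DFunLike.coe (DFunLike.congr_fun h γ))
      (F.direction.mkQ (D x))).symm.trans h1
  let g : C(M, F.Transverse) := Topology.IsQuotientMap.lift (f := ⟨p, cov.continuous⟩) hq f hinv
  have hgf : ∀ x, g (p x) = f x := fun x =>
    DFunLike.congr_fun (Topology.IsQuotientMap.lift_comp (f := ⟨p, cov.continuous⟩) hq f hinv) x
  -- One set seen twice: open as the image of `f`, compact as the image of `g`.
  have hrange : range f = range g := by
    rw [← cov.surjective.range_comp g]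
    exact congr_arg range (funext fun x => (hgf x).symm)
  -- Closedness of `U` makes the quotient Hausdorff, so that the compact image is closed.
  have : IsClosed (F.direction : Set (EuclideanSpace ℝ (Fin n))) :=
    F.direction.closed_of_finiteDimensional
  have : T2Space F.Transverse := inferInstanceAs (T2Space (EuclideanSpace ℝ (Fin n) ⧸ F.direction))
  have hcompact : IsCompact (range f) := hrange ▸ isCompact_range g.continuous
  have huniv : range f = univ :=
    IsClopen.eq_univ ⟨hcompact.isClosed, hf.isOpen_range⟩ (range_nonempty f)
  -- Positive codimension enters here: in codimension zero the quotient is a point, which is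
  -- compact.
  have : Nontrivial F.Transverse := Module.nontrivial_of_finrank_pos hF
  have := NormedSpace.noncompactSpace ℝ F.Transverse
  exact noncompact_univ F.Transverse (huniv ▸ hcompact)

theorem theorem4p1 {n : ℕ} {M N : Type*} [TopologicalSpace M]
    [ChartedSpace (EuclideanSpace ℝ (Fin n)) M] [IsAffineManifold n M] [CompactSpace M]
    [TopologicalSpace N] {p : N → M} (hp : IsUniversalCover p)
    {D : N → EuclideanSpace ℝ (Fin n)} (hD : IsDevelopingMap p D)
    (F : LinearFoliation hp hD) (o : F.TransverseOrientation) (hF : 0 < F.codim) :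
    F.globalHolonomy ≠ 1 := by
  have : ConnectedSpace M := IsAffineManifold.connected n
  exact F.globalHolonomy_ne_one hF
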